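/- All graphs are finite, simple, undirected and unweighted. For a graph $H$ and a set $S$ of its vertices, let $\mathrm{vol}_H(S)=\sum_{v\in S}\deg_H(v)$, let $\phi_H(S)=\dfrac{|E_H(S,\overline S)|}{\min\{\mathrm{vol}_H(S),\mathrm{vol}_H(\overline S)\}}$ be the conductance of $S$, and let $\phi(H)=\min_{\emptyset\ne S\subsetneq V(H)}\phi_H(S)$. Spectral partitioning on a graph $G=(V,E)$ without isolated vertices: let $D$ be the diagonal degree matrix, $M$ the adjacency matrix, $\mathcal L=I-D^{-1/2}MD^{-1/2}$, with eigenvalues $\lambda_1\le\lambda_2\le\cdots$ counted with multiplicity. Take a second eigenfunction $g$, i.e. $g\neq 0$, $\mathcal L g=\lambda_2 g$, $g\perp D^{1/2}\mathbf 1$ (any one), put $f=D^{-1/2}g$, and return a set of minimum conductance among the threshold sets $\{v: f(v)\ge t\}$, $t\in\mathbb R$, that are neither empty nor equal to $V$. **Corollary 4.15.** There is an absolute constant $C>0$ such that the following holds. Let $G=(V,E)$ be a graph and $V=A\cup B$ a partition into disjoint sets with $\mathrm{vol}_G(A)=\mathrm{vol}_G(B)$ and $\phi_G(A)=\phi_G(B)=\phi$.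 Let $G_A$, $G_B$ be the subgraphs of $G$ induced on $A$ and $B$, and let $\varphi>0$ satisfy $\varphi\le\min(\phi(G_A),\phi(G_B))$. Suppose that $G_A$ and $G_B$ have minimum degree at least $d_1>0$ and that the bipartite graph $(A\cup B,E(A,B))$ has maximum degree at most $d_2$. Then spectral partitioning applied to $G$ returns a set, and every set $S$ that it may return satisfies $$\phi_G(S)\le C\cdot\frac{\phi}{\varphi}\cdot\frac{d_1+d_2}{d_1}.$$ -/

import Mathlib

namespace SpectralCut

open Finset

section Defs

variable {V : Type*} [Fintype V] [DecidableEq V] (G : SimpleGraph V) [DecidableRel G.Adj]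

/-- The volume of a set of vertices: the sum of the degrees in `G`. -/
def vol (S : Finset V) : ℕ := ∑ v ∈ S, G.degree v

/-- The conductance `|E(S, Sᶜ)| / min (vol S) (vol Sᶜ)` of a set of vertices. As `S` and `Sᶜ` are
disjoint, `G.interedges S Sᶜ` holds every edge that leaves `S` exactly once. -/
noncomputable def conductance (S : Finset V) : ℝ :=
  ((G.interedges S Sᶜ).card : ℝ) / (min (vol G S) (vol G Sᶜ) : ℕ)

/-- A set of vertices that cuts the graph: neither empty nor everything. -/
def IsCut (S : Finset V) : Prop := S.Nonempty ∧ Sᶜ.Nonempty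

/-- The conductance of the graph: the minimum of `conductance G S` over all cuts `S`
(and `0` if there is no cut, that is, on at most one vertex). -/
noncomputable def graphConductance : ℝ :=
  ⨅ S : {S : Finset V // IsCut S}, conductance G S

/-- The normalized Laplacian `I - D^{-1/2} A D^{-1/2}`. -/
noncomputable def normLaplacian : Matrix V V ℝ :=
  1 - Matrix.diagonal (fun v => (Real.sqrt (G.degree v))⁻¹) * G.adjMatrix ℝ *
    Matrix.diagonal (fun v => (Real.sqrt (G.degree v))⁻¹)

theorem normLaplacian_isHermitian : (normLaplacian G).IsHermitian := by
  ext i j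
  simp only [normLaplacian, Matrix.conjTranspose_apply, Matrix.sub_apply,
    Matrix.mul_diagonal, Matrix.diagonal_mul, SimpleGraph.adjMatrix_apply, Matrix.one_apply,
    G.adj_comm j i, eq_comm (a := j) (b := i), star_trivial]
  ring

/-- The `k`-th smallest eigenvalue `λ_k` of the normalized Laplacian, counted with multiplicity,
for `1 ≤ k ≤ |V|` (and `0` for other `k`). Mathlib's `eigenvalues₀` lists the eigenvalues in
decreasing order, starting from index `0`. -/
noncomputable def eigenvalue (k : ℕ) : ℝ :=
  if h : 1 ≤ k ∧ k ≤ Fintype.card V then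
    (normLaplacian_isHermitian G).eigenvalues₀ ⟨Fintype.card V - k, by omega⟩
  else 0

/-- `g` is a second eigenfunction of the normalized Laplacian: a nonzero eigenfunction for `λ_2`
that is orthogonal to the first eigenfunction `D^{1/2} 1`. (The orthogonality is automatic
if `λ_2 > 0`, that is, if `G` is connected.) -/
def IsSecondEigenfunction (g : V → ℝ) : Prop :=
  g ≠ 0 ∧ (normLaplacian G).mulVec g = eigenvalue G 2 • g ∧
    ∑ v, Real.sqrt (G.degree v) * g v = 0

/-- The threshold set `{v | f v ≥ t}`. -/
noncomputable def thresholdSet (f : V → ℝ) (t : ℝ) : Finset V := {v | t ≤ f v}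

/-- `S` is a threshold set of `f` that is a cut, and has the minimum conductance among all
threshold sets of `f` that are cuts. -/
def IsBestThresholdCut (f : V → ℝ) (S : Finset V) : Prop :=
  IsCut S ∧ (∃ t, S = thresholdSet f t) ∧
    ∀ t, IsCut (thresholdSet f t) → conductance G S ≤ conductance G (thresholdSet f t)

/-- `S` is a possible output of the spectral partitioning algorithm on `G`: for some second
eigenfunction `g` of the normalized Laplacian (the algorithm may compute any of them),
`S` is a best threshold cut of `f = D^{-1/2} g`. -/
def IsSpectralPartition (S : Finset V) : Prop :=
  ∃ g : V → ℝ, IsSecondEigenfunction G g ∧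
    IsBestThresholdCut G (fun v => g v / Real.sqrt (G.degree v)) S

end Defs

end SpectralCut

namespace SpectralCut

open Finset

set_option linter.unusedSectionVars false

section Graph

variable {V : Type*} [Fintype V] [DecidableEq V] (G : SimpleGraph V) [DecidableRel G.Adj]

/-! Write `K = (d₁ + d₂) / d₁`, `E` for the sum of `(f u - f v) ^ 2` over ordered adjacent pairs,
`N` for the degree-weighted square norm of `f`, and `Φ` for the best conductance of a threshold cut.
The usual Cheeger argument applies an `L¹` isoperimetric inequality to the signed square of `f` and
gives `Φ` of order `√λ₂`. Here the signed square is replaced by a primitive `ψ` of the distance to a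
two-point set `{a, b}` (`distPrimitive`).

Increments of `ψ` are still at least quadratic, so the weighted `L¹` norm of `ψ ∘ f` around the
median controls `N`. But `ψ` is flat near `a` and `b`, so its variation along edges is bounded by
`E` and by the squared distance `P` of `f` from a function with values in `{a, b}`. This gives `Φ N
≲ (1 + s) E + P / s` for every `s > 0` (`mul_sum_sq_le_of_step`), which is linear in `λ₂` once `P`
is bounded by a multiple of `E`.

That bound comes from the expansion of the two sides: Cheeger's inequality in each induced graph
puts `f` close to a constant there, so `ϕ² P ≤ K E` (`exists_poincare_induce`), where `K` pays for
using degrees of `G`. With `s = ϕ⁻¹` and `E = 2 λ₂ N` this yields `Φ ≤ 24 K λ₂ / ϕ`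
(`conductance_le_of_step`). Finally `λ₂ ≤ 2 φ` by testing with functions constant on `A` and on `B`
(`eigenvalue_two_le`). -/

/-! ### Sums over adjacent pairs, cuts and conductance. -/

/-- The sum of `F u v` over all ordered pairs of adjacent vertices. -/
def adjSum (F : V → V → ℝ) : ℝ := ∑ u, ∑ v, if G.Adj u v then F u v else 0

variable {G}

theorem adjSum_add (F F' : V → V → ℝ) :
    adjSum G (fun u v => F u v + F' u v) = adjSum G F + adjSum G F' := by
  simp only [adjSum, ← sum_add_distrib]
  refine sum_congr rfl fun u _ => sum_congr rfl fun v _ => ?_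
  split_ifs <;> simp

theorem adjSum_const_mul (c : ℝ) (F : V → V → ℝ) :
    adjSum G (fun u v => c * F u v) = c * adjSum G F := by
  simp only [adjSum, mul_sum, mul_ite, mul_zero]

theorem adjSum_mono {F F' : V → V → ℝ} (h : ∀ u v, F u v ≤ F' u v) :
    adjSum G F ≤ adjSum G F' := by
  refine sum_le_sum fun u _ => sum_le_sum fun v _ => ?_
  split_ifs
  · exact h u v
  · exact le_rfl

theorem adjSum_nonneg {F : V → V → ℝ} (h : ∀ u v, 0 ≤ F u v) : 0 ≤ adjSum G F := by
  refine sum_nonneg fun u _ => sum_nonneg fun v _ => ?_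
  split_ifs
  · exact h u v
  · exact le_rfl

theorem adjSum_swap (F : V → V → ℝ) : adjSum G (fun u v => F v u) = adjSum G F := by
  unfold adjSum
  rw [sum_comm]
  simp only [G.adj_comm]

theorem adjSum_left (F : V → ℝ) : adjSum G (fun u _ => F u) = ∑ u, (G.degree u : ℝ) * F u := by
  unfold adjSum
  refine sum_congr rfl fun u _ => ?_
  rw [← sum_filter, sum_const, nsmul_eq_mul, ← SimpleGraph.neighborFinset_eq_filter,
    SimpleGraph.card_neighborFinset_eq_degree]

theorem adjSum_right (F : V → ℝ) : adjSum G (fun _ v => F v) = ∑ u, (G.degree u : ℝ) * F u := by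
  rw [← adjSum_left, ← adjSum_swap]

theorem adjSum_indicator (S : Finset V) :
    adjSum G (fun u v => |(if u ∈ S then (1 : ℝ) else 0) - if v ∈ S then 1 else 0|) =
      2 * (G.interedges S Sᶜ).card := by
  have h1 : adjSum G (fun u v => if u ∈ S ∧ v ∈ Sᶜ then (1 : ℝ) else 0) =
      (G.interedges S Sᶜ).card := by
    unfold adjSum SimpleGraph.interedges Rel.interedges
    rw [card_filter, sum_product, Nat.cast_sum]
    rw [← sum_subset (subset_univ S)]
    · refine sum_congr rfl fun u hu => ?_
      rw [Nat.cast_sum, ← sum_subset (subset_univ Sᶜ)]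
      · refine sum_congr rfl fun v hv => ?_
        simp [hu, mem_compl.1 hv]
      · intro v _ hv
        simp [hv]
    · intro u _ hu
      simp [hu]
  have h2 : adjSum G (fun u v => if v ∈ S ∧ u ∈ Sᶜ then (1 : ℝ) else 0) =
      (G.interedges S Sᶜ).card := by
    rw [← h1, ← adjSum_swap]
  rw [two_mul]
  nth_rewrite 1 [← h1]
  rw [← h2, ← adjSum_add]
  congr 1
  funext u v
  by_cases hu : u ∈ S <;> by_cases hv : v ∈ S <;> simp [hu, hv]

theorem card_interedges_compl (S : Finset V) :
    (G.interedges Sᶜ Sᶜᶜ).card = (G.interedges S Sᶜ).card := by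
  rw [compl_compl]
  have : Std.Symm G.Adj := G.symm
  exact Rel.card_interedges_comm _ _

theorem conductance_compl (S : Finset V) : conductance G Sᶜ = conductance G S := by
  unfold conductance
  rw [card_interedges_compl, compl_compl, min_comm]

theorem card_interedges_le_vol (S T : Finset V) : (G.interedges S T).card ≤ vol G S := by
  unfold SimpleGraph.interedges Rel.interedges vol
  rw [card_filter, sum_product]
  refine sum_le_sum fun u _ => ?_
  rw [← card_filter, ← SimpleGraph.card_neighborFinset_eq_degree]
  refine card_le_card fun v hv => ?_
  simpa using (mem_filter.1 hv).2

theorem conductance_le_one (S : Finset V) : conductance G S ≤ 1 := by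
  unfold conductance
  refine div_le_one_of_le₀ ?_ (Nat.cast_nonneg _)
  refine Nat.cast_le.2 (le_min (card_interedges_le_vol _ _) ?_)
  rw [← card_interedges_compl]
  exact card_interedges_le_vol _ _

theorem conductance_nonneg (S : Finset V) : 0 ≤ conductance G S := by
  unfold conductance
  positivity

theorem graphConductance_le {S : Finset V} (hS : IsCut S) :
    graphConductance G ≤ conductance G S :=
  ciInf_le (f := fun S : {S : Finset V // IsCut S} => conductance G S)
    ⟨0, by rintro _ ⟨S, rfl⟩; exact conductance_nonneg _⟩ ⟨S, hS⟩

/-- An infimum over an empty type is `0`, so positive conductance excludes graphs on at most one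
vertex. -/
theorem exists_isCut_of_graphConductance_pos (h : 0 < graphConductance G) :
    ∃ S : Finset V, IsCut S := by
  by_contra! hc
  have : IsEmpty {S : Finset V // IsCut S} := ⟨fun S => hc S.1 S.2⟩
  rw [graphConductance, Real.iInf_of_isEmpty] at h
  exact lt_irrefl _ h

theorem vol_add_vol_compl (S : Finset V) : vol G S + vol G Sᶜ = vol G univ :=
  sum_add_sum_compl _ _

theorem vol_mono {S T : Finset V} (h : S ⊆ T) : vol G S ≤ vol G T :=
  sum_le_sum_of_subset h

theorem mul_vol_le_card_interedges {Φ : ℝ} {S : Finset V} (h : Φ ≤ conductance G S)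
    (hS : vol G S ≤ vol G Sᶜ) : Φ * vol G S ≤ (G.interedges S Sᶜ).card := by
  unfold conductance at h
  rw [min_eq_left hS] at h
  rcases Nat.eq_zero_or_pos (vol G S) with h0 | h0
  · simp [h0]
  · rwa [le_div_iff₀ (Nat.cast_pos.2 h0)] at h

/-! ### From threshold cuts to an `L¹` isoperimetric inequality. -/

/-- A nonnegative function satisfies an isoperimetric inequality if its superlevel sets do. -/
theorem mul_sum_degree_le_adjSum_of_nonneg (Φ : ℝ) (p : V → ℝ) (hp : ∀ v, 0 ≤ p v)
    (h : ∀ t, 0 < t → Φ * vol G {v | t ≤ p v} ≤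
      (G.interedges {v | t ≤ p v} ({v | t ≤ p v} : Finset V)ᶜ).card) :
    2 * (Φ * ∑ v, (G.degree v : ℝ) * p v) ≤ adjSum G (fun u v => |p u - p v|) := by
  induction hn : ({v | 0 < p v} : Finset V).card using Nat.strong_induction_on generalizing p with
  | _ n ih =>
  subst hn
  rcases ({v | 0 < p v} : Finset V).eq_empty_or_nonempty with he | hne
  · have hz : ∀ v, p v = 0 := fun v => by
      refine le_antisymm (not_lt.1 fun hv => ?_) (hp v)
      have : v ∈ ({v | 0 < p v} : Finset V) := by simpa using hv
      simp [he] at this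
    simp [hz, adjSum]
  -- A discrete co-area argument: with `δ` the least positive value, `p` is `δ` times the indicator
  -- of its support plus a function `q` of smaller support, and both sides of the inequality are
  -- additive in this decomposition.
  · obtain ⟨w, hw, hmin⟩ := exists_min_image _ p hne
    simp only [mem_filter, mem_univ, true_and] at hw hmin
    set δ := p w with hδ
    set S : Finset V := {v | δ ≤ p v} with hS
    have hmem : ∀ v, v ∈ S ↔ δ ≤ p v := fun v => by simp [hS]
    have hn0 : ¬ δ ≤ 0 := hw.not_ge
    have hnot : ∀ v, ¬ δ ≤ p v → p v = 0 := fun v hv =>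
      le_antisymm (not_lt.1 fun h0 => hv (hmin v h0)) (hp v)
    set q : V → ℝ := fun v => if δ ≤ p v then p v - δ else 0 with hq
    have hlev : ∀ t, 0 < t → ({v | t ≤ q v} : Finset V) = ({v | t + δ ≤ p v} : Finset V) := by
      intro t ht
      ext v
      simp only [mem_filter, mem_univ, true_and, hq]
      split_ifs with hv
      · constructor <;> intro <;> linarith
      · constructor <;> intro <;> linarith
    have hq0 : ∀ v, 0 ≤ q v := fun v => by
      simp only [hq]; split_ifs <;> linarith
    have hcard : ({v | 0 < q v} : Finset V).card < ({v | 0 < p v} : Finset V).card := by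
      refine card_lt_card ⟨fun v => ?_, fun hsub => ?_⟩
      · simp only [mem_filter, mem_univ, true_and, hq]
        split_ifs <;> intro <;> linarith
      · have := hsub (show w ∈ ({v | 0 < p v} : Finset V) by simpa using hw)
        simp [hq, ← hδ] at this
    have hi := ih _ hcard q hq0 (fun t ht => by
      rw [hlev t ht]; exact h _ (by linarith)) rfl
    have hsum : ∑ v, (G.degree v : ℝ) * p v = ∑ v, (G.degree v : ℝ) * q v + δ * vol G S := by
      have : (vol G S : ℝ) = ∑ v, if v ∈ S then (G.degree v : ℝ) else 0 := by
        rw [vol, Nat.cast_sum, sum_ite_mem, univ_inter]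
      rw [this, mul_sum, ← sum_add_distrib]
      refine sum_congr rfl fun v _ => ?_
      by_cases hv : δ ≤ p v
      · simp only [hq, hmem, hv, if_true]; ring
      · simp [hq, hmem, hnot v hv, hn0]
    have hadj : adjSum G (fun u v => |p u - p v|) =
        adjSum G (fun u v => |q u - q v|) + δ * (2 * (G.interedges S Sᶜ).card) := by
      rw [← adjSum_indicator, ← adjSum_const_mul, ← adjSum_add]
      congr 1
      funext u v
      by_cases hu : δ ≤ p u <;> by_cases hv : δ ≤ p v
      · simp [hq, hmem, hu, hv]
      · simp only [hq, hmem, hu, if_true, if_false, hn0, hnot v hv, sub_zero, abs_one]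
        rw [abs_of_nonneg (by linarith), abs_of_nonneg (by linarith)]; ring
      · simp only [hq, hmem, hv, if_true, if_false, hn0, hnot u hu, zero_sub, abs_neg, abs_one]
        rw [abs_of_nonneg (by linarith), abs_of_nonneg (by linarith)]; ring
      · simp [hq, hmem, hnot u hu, hnot v hv]
    have hc := mul_le_mul_of_nonneg_left (h δ hw) hw.le
    rw [hsum, hadj]
    linarith

/-- Every function on the vertices has a median with respect to the volume. -/
theorem exists_median [Nonempty V] (f : V → ℝ) :
    ∃ w, 2 * vol G {v | f w < f v} ≤ vol G univ ∧ 2 * vol G {v | f v < f w} ≤ vol G univ := by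
  obtain ⟨x, -, hx⟩ := exists_max_image univ f univ_nonempty
  have hne : ({w | 2 * vol G {v | f w < f v} ≤ vol G univ} : Finset V).Nonempty := by
    refine ⟨x, mem_filter.2 ⟨mem_univ _, ?_⟩⟩
    have : ({v | f x < f v} : Finset V) = ∅ := by
      ext v; simpa using hx v (mem_univ _)
    rw [this]
    simp [vol]
  -- The least value with at most half the volume above it is a median: otherwise the next smaller
  -- value `f u` would also have at most half above it.
  obtain ⟨w, hw, hmin⟩ := exists_min_image _ f hne
  simp only [mem_filter, mem_univ, true_and] at hw hmin
  refine ⟨w, hw, ?_⟩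
  by_contra! hlt
  have hne' : ({v | f v < f w} : Finset V).Nonempty := by
    by_contra he
    rw [not_nonempty_iff_eq_empty] at he
    simp [he, vol] at hlt
  obtain ⟨u, hu, hmax⟩ := exists_max_image _ f hne'
  simp only [mem_filter, mem_univ, true_and] at hu hmax
  refine absurd (hmin u ?_) (not_le.2 hu)
  have hc : ({v | f u < f v} : Finset V) = ({v | f v < f w} : Finset V)ᶜ := by
    ext v
    simp only [mem_filter, mem_univ, true_and, mem_compl, not_lt]
    constructor
    · intro h; by_contra! h'; exact absurd (hmax v h') (not_le.2 h)
    · intro h; exact hu.trans_le h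
  have := vol_add_vol_compl (G := G) ({v | f v < f w} : Finset V)
  rw [hc]
  omega

theorem exists_eq_thresholdSet (f : V → ℝ) {S : Finset V} (hS : S.Nonempty)
    (h : ∀ u ∈ S, ∀ v, f u ≤ f v → v ∈ S) : ∃ t, S = thresholdSet f t := by
  obtain ⟨w, hw, hmin⟩ := exists_min_image S f hS
  refine ⟨f w, ?_⟩
  ext v
  simp only [thresholdSet, mem_filter, mem_univ, true_and]
  exact ⟨hmin v, h w hw v⟩

/-- If all threshold cuts of `f` have conductance at least `Φ`, then every monotone
function of `f` satisfies an `L¹` isoperimetric inequality around the median of `f`. -/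
theorem exists_mul_sum_le_adjSum [Nonempty V] (f : V → ℝ) (Φ : ℝ)
    (h : ∀ t, IsCut (thresholdSet f t) → Φ ≤ conductance G (thresholdSet f t)) :
    ∃ m, ∀ ψ : ℝ → ℝ, Monotone ψ →
      2 * (Φ * ∑ v, (G.degree v : ℝ) * |ψ (f v) - ψ m|) ≤
        adjSum G (fun u v => |ψ (f u) - ψ (f v)|) := by
  obtain ⟨w, hw1, hw2⟩ := exists_median (G := G) f
  refine ⟨f w, fun ψ hψ => ?_⟩
  have hgen : ∀ S : Finset V, IsCut S → (∃ t, S = thresholdSet f t) → Φ ≤ conductance G S := by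
    rintro S hS ⟨t, rfl⟩
    exact h t hS
  -- The positive and negative parts of `ψ ∘ f - ψ m` are treated separately. Their superlevel sets
  -- avoid the median, so they hold at most half the volume; those of the negative part are
  -- complements of threshold sets.
  have h1 := mul_sum_degree_le_adjSum_of_nonneg (G := G) Φ (fun v => max (ψ (f v) - ψ (f w)) 0)
    (fun v => le_max_right _ _) (by
      intro t ht
      set S : Finset V := {v | t ≤ max (ψ (f v) - ψ (f w)) 0} with hS
      have hmem : ∀ v, v ∈ S ↔ t ≤ ψ (f v) - ψ (f w) := fun v => by
        simp [hS, ht.not_ge]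
      rcases S.eq_empty_or_nonempty with he | hne
      · simp [he, vol]
      have hsub : S ⊆ ({v | f w < f v} : Finset V) := fun v hv => by
        rw [hmem] at hv
        simp only [mem_filter, mem_univ, true_and]
        by_contra! hle
        linarith [hψ hle]
      have hv1 := vol_mono (G := G) hsub
      have hv2 := vol_add_vol_compl (G := G) S
      refine mul_vol_le_card_interedges (hgen S ⟨hne, w, ?_⟩ ?_) (by omega)
      · simp [hmem, ht]
      · refine exists_eq_thresholdSet f hne fun u hu v huv => ?_
        rw [hmem] at hu ⊢
        linarith [hψ huv])
  have h2 := mul_sum_degree_le_adjSum_of_nonneg (G := G) Φ (fun v => max (ψ (f w) - ψ (f v)) 0)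
    (fun v => le_max_right _ _) (by
      intro t ht
      set S : Finset V := {v | t ≤ max (ψ (f w) - ψ (f v)) 0} with hS
      have hmem : ∀ v, v ∈ S ↔ t ≤ ψ (f w) - ψ (f v) := fun v => by
        simp [hS, ht.not_ge]
      rcases S.eq_empty_or_nonempty with he | hne
      · simp [he, vol]
      have hsub : S ⊆ ({v | f v < f w} : Finset V) := fun v hv => by
        rw [hmem] at hv
        simp only [mem_filter, mem_univ, true_and]
        by_contra! hle
        linarith [hψ hle]
      have hv1 := vol_mono (G := G) hsub
      have hv2 := vol_add_vol_compl (G := G) S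
      have hwc : w ∈ Sᶜ := by simp [hmem, ht]
      refine mul_vol_le_card_interedges ?_ (by omega)
      rw [← conductance_compl]
      refine hgen Sᶜ ⟨⟨w, hwc⟩, by rwa [compl_compl]⟩ ?_
      refine exists_eq_thresholdSet f ⟨w, hwc⟩ fun u hu v huv => ?_
      rw [mem_compl, hmem] at hu ⊢
      intro hv
      exact hu (by linarith [hψ huv]))
  have hs : ∀ x y : ℝ, max (x - y) 0 + max (y - x) 0 = |x - y| := fun x y => by
    rcases le_total x y with hxy | hxy
    · rw [max_eq_right (by linarith), max_eq_left (by linarith), abs_of_nonpos (by linarith)]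
      ring
    · rw [max_eq_left (by linarith), max_eq_right (by linarith), abs_of_nonneg (by linarith)]
      ring
  have hd : ∀ x y z : ℝ, |max (x - z) 0 - max (y - z) 0| + |max (z - x) 0 - max (z - y) 0| =
      |x - y| := fun x y z => by
    rcases le_total x z with hx | hx <;> rcases le_total y z with hy | hy
    · rw [max_eq_right (by linarith), max_eq_right (by linarith), max_eq_left (by linarith),
        max_eq_left (by linarith), sub_self, abs_zero, zero_add, abs_sub_comm]
      congr 1; ring
    · rw [max_eq_right (by linarith), max_eq_left (by linarith), max_eq_left (by linarith),
        max_eq_right (by linarith), abs_of_nonpos (by linarith), abs_of_nonneg (by linarith),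
        abs_of_nonpos (by linarith)]
      ring
    · rw [max_eq_left (by linarith), max_eq_right (by linarith), max_eq_right (by linarith),
        max_eq_left (by linarith), abs_of_nonneg (by linarith), abs_of_nonpos (by linarith),
        abs_of_nonneg (by linarith)]
      ring
    · rw [max_eq_left (by linarith), max_eq_left (by linarith), max_eq_right (by linarith),
        max_eq_right (by linarith), sub_self, abs_zero, add_zero]
      congr 1; ring
  have h3 := add_le_add h1 h2
  rw [← adjSum_add, ← mul_add, ← mul_add, ← sum_add_distrib] at h3
  simp only [← mul_add, hs, hd] at h3
  exact h3

/-! ### Primitives of distance functions on the line. -/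

/-- The signed square `x |x| / 2`. -/
noncomputable def halfSignedSq (x : ℝ) : ℝ := x * |x| / 2

/-- Among intervals of given length, the integral of `|t|` is smallest on the one centred at `0`,
where equality holds. -/
theorem sq_le_halfSignedSq_sub {x y : ℝ} (h : x ≤ y) :
    (y - x) ^ 2 / 4 ≤ halfSignedSq y - halfSignedSq x := by
  unfold halfSignedSq
  rcases abs_cases x with ⟨hx, _⟩ | ⟨hx, _⟩ <;> rcases abs_cases y with ⟨hy, _⟩ | ⟨hy, _⟩ <;>
    rw [hx, hy] <;> nlinarith [sq_nonneg (x + y), sq_nonneg (x - y)]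

theorem monotone_halfSignedSq : Monotone halfSignedSq := fun x y h => by
  have := sq_le_halfSignedSq_sub h
  nlinarith [sq_nonneg (y - x)]

/-- The trapezoid bound for the integral of the convex function `|t|`. -/
theorem halfSignedSq_sub_le {x y : ℝ} (h : x ≤ y) :
    halfSignedSq y - halfSignedSq x ≤ (y - x) * (|x| + |y|) / 2 := by
  unfold halfSignedSq
  rcases abs_cases x with ⟨hx, _⟩ | ⟨hx, _⟩ <;> rcases abs_cases y with ⟨hy, _⟩ | ⟨hy, _⟩ <;>
    rw [hx, hy] <;> nlinarith

theorem abs_halfSignedSq_sub_le (x y : ℝ) :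
    |halfSignedSq x - halfSignedSq y| ≤ |x - y| * (|x| + |y|) / 2 := by
  rcases le_total x y with h | h
  · rw [abs_sub_comm, abs_sub_comm x y, abs_of_nonneg (sub_nonneg.2 (monotone_halfSignedSq h)),
      abs_of_nonneg (sub_nonneg.2 h)]
    exact halfSignedSq_sub_le h
  · rw [abs_of_nonneg (sub_nonneg.2 (monotone_halfSignedSq h)),
      abs_of_nonneg (sub_nonneg.2 h), add_comm]
    exact halfSignedSq_sub_le h

/-- A primitive of the distance to `{a, b}`, for `a ≤ b`. -/
noncomputable def distPrimitive (a b x : ℝ) : ℝ :=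
  halfSignedSq (min x ((a + b) / 2) - a) + halfSignedSq (max x ((a + b) / 2) - b)

theorem monotone_distPrimitive (a b : ℝ) : Monotone (distPrimitive a b) := fun _ _ h =>
  add_le_add (monotone_halfSignedSq (sub_le_sub_right (min_le_min_right _ h) _))
    (monotone_halfSignedSq (sub_le_sub_right (max_le_max_right _ h) _))

/-- Cutting the interval at the midpoint of `a` and `b` leaves two lengths `p` and `q`, each
contributing at least a quarter of its square, and `(p + q) ^ 2 ≤ 2 * (p ^ 2 + q ^ 2)`. -/
theorem sq_le_distPrimitive_sub (a b : ℝ) {x y : ℝ} (h : x ≤ y) :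
    (y - x) ^ 2 / 8 ≤ distPrimitive a b y - distPrimitive a b x := by
  unfold distPrimitive
  set c := (a + b) / 2
  have h1 := sq_le_halfSignedSq_sub (sub_le_sub_right (min_le_min_right c h) a)
  have h2 := sq_le_halfSignedSq_sub (sub_le_sub_right (max_le_max_right c h) b)
  have hx := min_add_max x c
  have hy := min_add_max y c
  have : y - x = (min y c - a - (min x c - a)) + (max y c - b - (max x c - b)) := by linarith
  rw [this]
  nlinarith [sq_nonneg ((min y c - a - (min x c - a)) - (max y c - b - (max x c - b)))]

theorem sq_le_abs_distPrimitive_sub (a b x y : ℝ) :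
    (x - y) ^ 2 / 8 ≤ |distPrimitive a b x - distPrimitive a b y| := by
  rcases le_total x y with h | h
  · rw [abs_sub_comm, ← neg_sq, neg_sub]
    exact (sq_le_distPrimitive_sub a b h).trans (le_abs_self _)
  · exact (sq_le_distPrimitive_sub a b h).trans (le_abs_self _)

/-- The trapezoid bound on each side of the midpoint, with the distance to the nearer of `a`, `b`
replaced by the distance to an arbitrary choice. The last term `y - x` is needed when the interval
crosses the midpoint, to bound the distance there. -/
theorem distPrimitive_sub_le {a b x y α β : ℝ} (hab : a ≤ b) (h : x ≤ y) (hα : α = a ∨ α = b)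
    (hβ : β = a ∨ β = b) :
    distPrimitive a b y - distPrimitive a b x ≤ (y - x) * (|x - α| + |y - β| + (y - x)) := by
  unfold distPrimitive
  set c := (a + b) / 2 with hc
  have key : ∀ z, (z ≤ c → ∀ α, (α = a ∨ α = b) → |z - a| ≤ |z - α|) ∧
      (c ≤ z → ∀ α, (α = a ∨ α = b) → |z - b| ≤ |z - α|) := by
    intro z
    constructor
    · rintro hz α (rfl | rfl)
      · exact le_rfl
      · rw [abs_of_nonpos (a := z - α) (by linarith), abs_le]
        constructor <;> linarith
    · rintro hz α (rfl | rfl)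
      · rw [abs_of_nonneg (a := z - α) (by linarith), abs_le]
        constructor <;> linarith
      · exact le_rfl
  have hd : 0 ≤ y - x := sub_nonneg.2 h
  rcases le_total y c with hy | hy
  · rw [min_eq_left hy, min_eq_left (h.trans hy), max_eq_right hy, max_eq_right (h.trans hy)]
    have h1 := halfSignedSq_sub_le (sub_le_sub_right h a)
    have h2 := (key x).1 (h.trans hy) α hα
    have h3 := (key y).1 hy β hβ
    nlinarith [mul_le_mul_of_nonneg_left h2 hd, mul_le_mul_of_nonneg_left h3 hd,
      mul_nonneg hd (abs_nonneg (x - a)), mul_nonneg hd (abs_nonneg (y - a))]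
  rcases le_total x c with hx | hx
  · rw [min_eq_right hy, min_eq_left hx, max_eq_left hy, max_eq_right hx]
    have h1 := halfSignedSq_sub_le (sub_le_sub_right hx a)
    have h2 := halfSignedSq_sub_le (sub_le_sub_right hy b)
    have h3 := (key x).1 hx α hα
    have h4 := (key y).2 hy β hβ
    have h5 : |c - a| ≤ |x - a| + (c - x) := by
      rw [abs_of_nonneg (by linarith)]; linarith [le_abs_self (x - a)]
    have h6 : |c - b| ≤ |y - b| + (y - c) := by
      rw [abs_of_nonpos (by linarith)]; linarith [neg_abs_le (y - b)]
    have e1 : (c - x) * (|x - a| + |c - a|) ≤ (c - x) * (2 * (|x - α| + |y - β| + (y - x))) :=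
      mul_le_mul_of_nonneg_left (by linarith [abs_nonneg (y - β)]) (by linarith)
    have e2 : (y - c) * (|c - b| + |y - b|) ≤ (y - c) * (2 * (|x - α| + |y - β| + (y - x))) :=
      mul_le_mul_of_nonneg_left (by linarith [abs_nonneg (x - α)]) (by linarith)
    rw [sub_sub_sub_cancel_right] at h1 h2
    linarith
  · rw [min_eq_right hy, min_eq_right hx, max_eq_left hy, max_eq_left hx]
    have h1 := halfSignedSq_sub_le (sub_le_sub_right h b)
    have h2 := (key x).2 hx α hα
    have h3 := (key y).2 hy β hβ
    nlinarith [mul_le_mul_of_nonneg_left h2 hd, mul_le_mul_of_nonneg_left h3 hd,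
      mul_nonneg hd (abs_nonneg (x - b)), mul_nonneg hd (abs_nonneg (y - b))]

theorem abs_distPrimitive_sub_le {a b x y α β : ℝ} (hab : a ≤ b) (hα : α = a ∨ α = b)
    (hβ : β = a ∨ β = b) :
    |distPrimitive a b x - distPrimitive a b y| ≤
      |x - y| * (|x - α| + |y - β| + |x - y|) := by
  rcases le_total x y with h | h
  · rw [abs_sub_comm, abs_sub_comm x y,
      abs_of_nonneg (sub_nonneg.2 (monotone_distPrimitive a b h)),
      abs_of_nonneg (sub_nonneg.2 h)]
    exact distPrimitive_sub_le hab h hα hβ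
  · rw [abs_of_nonneg (sub_nonneg.2 (monotone_distPrimitive a b h)),
      abs_of_nonneg (sub_nonneg.2 h), add_comm |x - α|]
    exact distPrimitive_sub_le hab h hβ hα

/-! ### Cheeger's inequality and its refinement for functions near a step function. -/

/-- The hard direction of Cheeger's inequality, as a Poincaré inequality. -/
theorem exists_poincare [Nonempty V] {ϕ : ℝ} (hϕ : 0 < ϕ) (h : ϕ ≤ graphConductance G)
    (f : V → ℝ) :
    ∃ m, ϕ ^ 2 * ∑ v, (G.degree v : ℝ) * (f v - m) ^ 2 ≤
      adjSum G (fun u v => (f u - f v) ^ 2) := by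
  obtain ⟨m, hm⟩ := exists_mul_sum_le_adjSum (G := G) f ϕ
    fun t ht => h.trans (graphConductance_le ht)
  refine ⟨m, ?_⟩
  have h1 := hm (fun x => halfSignedSq (x - m))
    fun x y hxy => monotone_halfSignedSq (sub_le_sub_right hxy m)
  have h2 : ∀ v, |halfSignedSq (f v - m) - halfSignedSq (m - m)| = (f v - m) ^ 2 / 2 := fun v => by
    rw [halfSignedSq, halfSignedSq, sub_self, zero_mul, zero_div, sub_zero, abs_div, abs_mul,
      abs_abs, abs_mul_abs_self, abs_two, sq]
  simp only [h2] at h1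
  set N := ∑ v, (G.degree v : ℝ) * (f v - m) ^ 2 with hN
  have h3 : ∑ v, (G.degree v : ℝ) * ((f v - m) ^ 2 / 2) = N / 2 := by
    rw [hN, sum_div]
    exact sum_congr rfl fun v _ => by ring
  rw [h3] at h1
  -- Weighted AM-GM, the weight `ϕ / 4` being chosen so that the two `N`-terms add up to half of the
  -- left side `ϕ * N` and can be absorbed.
  have h4 : adjSum G (fun u v => |halfSignedSq (f u - m) - halfSignedSq (f v - m)|) ≤
      adjSum G (fun u v => (2 * ϕ)⁻¹ * (f u - f v) ^ 2 +
        ((ϕ / 4) * (f u - m) ^ 2 + (ϕ / 4) * (f v - m) ^ 2)) := by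
    refine adjSum_mono fun u v => ?_
    have h5 := abs_halfSignedSq_sub_le (f u - m) (f v - m)
    rw [sub_sub_sub_cancel_right] at h5
    refine h5.trans ?_
    have h6 : (2 * ϕ)⁻¹ * (f u - f v) ^ 2 + ((ϕ / 4) * (f u - m) ^ 2 + (ϕ / 4) * (f v - m) ^ 2) -
        |f u - f v| * (|f u - m| + |f v - m|) / 2 =
        (2 * ϕ)⁻¹ * (|f u - f v| - ϕ / 2 * (|f u - m| + |f v - m|)) ^ 2 +
          ϕ / 8 * (|f u - m| - |f v - m|) ^ 2 := by
      rw [← sq_abs (f u - f v), ← sq_abs (f u - m), ← sq_abs (f v - m)]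
      field_simp
      ring
    have : 0 ≤ (2 * ϕ)⁻¹ * (|f u - f v| - ϕ / 2 * (|f u - m| + |f v - m|)) ^ 2 +
          ϕ / 8 * (|f u - m| - |f v - m|) ^ 2 := by positivity
    linarith
  rw [adjSum_add, adjSum_add, adjSum_const_mul, adjSum_left (fun v => ϕ / 4 * (f v - m) ^ 2),
    adjSum_right (fun v => ϕ / 4 * (f v - m) ^ 2)] at h4
  have h7 : ∑ v, (G.degree v : ℝ) * (ϕ / 4 * (f v - m) ^ 2) = ϕ / 4 * N := by
    rw [hN, mul_sum]
    exact sum_congr rfl fun v _ => by ring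
  rw [h7] at h4
  have h8 : ϕ / 2 * N ≤ (2 * ϕ)⁻¹ * adjSum G (fun u v => (f u - f v) ^ 2) := by linarith
  have h9 := mul_le_mul_of_nonneg_left h8 (show 0 ≤ 2 * ϕ by positivity)
  rw [mul_inv_cancel_left₀ (by positivity)] at h9
  linarith

/-- The `L¹` inequality for `distPrimitive`: its quadratic lower bound produces the left side, and
its upper bound with AM-GM of parameter `s` produces the right side. The `4` is the `8` of the lower
bound divided by the `2` of the `L¹` inequality. -/
theorem mul_sum_sq_le_of_step [Nonempty V] {f g : V → ℝ} {Φ a b s : ℝ} (hΦ : 0 ≤ Φ)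
    (h : ∀ t, IsCut (thresholdSet f t) → Φ ≤ conductance G (thresholdSet f t))
    (hg : ∀ v, g v = a ∨ g v = b) (hf : ∑ v, (G.degree v : ℝ) * f v = 0) (hs : 0 < s) :
    Φ * ∑ v, (G.degree v : ℝ) * f v ^ 2 ≤
      4 * ((1 + s) * adjSum G (fun u v => (f u - f v) ^ 2) +
        s⁻¹ * ∑ v, (G.degree v : ℝ) * (f v - g v) ^ 2) := by
  obtain ⟨m, hm⟩ := exists_mul_sum_le_adjSum (G := G) f Φ h
  have hg' : ∀ v, g v = min a b ∨ g v = max a b := fun v => by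
    rcases le_total a b with hab | hab
    · simpa [hab] using hg v
    · simpa [hab] using (hg v).symm
  have h1 := hm (distPrimitive (min a b) (max a b)) (monotone_distPrimitive _ _)
  -- The weighted mean of `f` is `0`, and the mean minimizes the weighted square distance to
  -- constants, so moving the centre to the median only helps.
  have h2 : ∑ v, (G.degree v : ℝ) * f v ^ 2 ≤ ∑ v, (G.degree v : ℝ) * (f v - m) ^ 2 := by
    have : ∑ v, (G.degree v : ℝ) * (f v - m) ^ 2 = ∑ v, (G.degree v : ℝ) * f v ^ 2 -
        2 * m * ∑ v, (G.degree v : ℝ) * f v + ∑ v, (G.degree v : ℝ) * m ^ 2 := by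
      rw [mul_sum, ← sum_sub_distrib, ← sum_add_distrib]
      exact sum_congr rfl fun v _ => by ring
    rw [this, hf, mul_zero, sub_zero]
    exact le_add_of_nonneg_right (sum_nonneg fun v _ => by positivity)
  have h3 : (∑ v, (G.degree v : ℝ) * f v ^ 2) / 8 ≤ ∑ v, (G.degree v : ℝ) *
      |distPrimitive (min a b) (max a b) (f v) - distPrimitive (min a b) (max a b) m| := by
    refine (div_le_div_of_nonneg_right h2 (by norm_num)).trans ?_
    rw [sum_div]
    refine sum_le_sum fun v _ => ?_
    rw [mul_div_assoc]
    exact mul_le_mul_of_nonneg_left (sq_le_abs_distPrimitive_sub _ _ _ _) (Nat.cast_nonneg _)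
  have h4 : adjSum G (fun u v => |distPrimitive (min a b) (max a b) (f u) -
      distPrimitive (min a b) (max a b) (f v)|) ≤
      adjSum G (fun u v => (1 + s) * (f u - f v) ^ 2 +
        ((s⁻¹ / 2) * (f u - g u) ^ 2 + (s⁻¹ / 2) * (f v - g v) ^ 2)) := by
    refine adjSum_mono fun u v => ?_
    refine (abs_distPrimitive_sub_le min_le_max (hg' u) (hg' v)).trans ?_
    have h6 : (1 + s) * (f u - f v) ^ 2 +
        ((s⁻¹ / 2) * (f u - g u) ^ 2 + (s⁻¹ / 2) * (f v - g v) ^ 2) -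
        |f u - f v| * (|f u - g u| + |f v - g v| + |f u - f v|) =
        s⁻¹ / 2 * (|f u - g u| - s * |f u - f v|) ^ 2 +
        s⁻¹ / 2 * (|f v - g v| - s * |f u - f v|) ^ 2 := by
      rw [← sq_abs (f u - f v), ← sq_abs (f u - g u), ← sq_abs (f v - g v)]
      field_simp
      ring
    have : 0 ≤ s⁻¹ / 2 * (|f u - g u| - s * |f u - f v|) ^ 2 +
        s⁻¹ / 2 * (|f v - g v| - s * |f u - f v|) ^ 2 := by positivity
    linarith
  rw [adjSum_add, adjSum_add, adjSum_const_mul, adjSum_left (fun v => s⁻¹ / 2 * (f v - g v) ^ 2),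
    adjSum_right (fun v => s⁻¹ / 2 * (f v - g v) ^ 2)] at h4
  have h7 : ∑ v, (G.degree v : ℝ) * (s⁻¹ / 2 * (f v - g v) ^ 2) =
      s⁻¹ / 2 * ∑ v, (G.degree v : ℝ) * (f v - g v) ^ 2 := by
    rw [mul_sum]
    exact sum_congr rfl fun v _ => by ring
  rw [h7] at h4
  have h8 := mul_le_mul_of_nonneg_left h3 hΦ
  linarith

/-! ### The normalized Laplacian and its second eigenvalue. -/

theorem dotProduct_normLaplacian_mulVec (hdeg : ∀ v, 0 < G.degree v) (f : V → ℝ) :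
    (fun v => √(G.degree v) * f v) ⬝ᵥ (normLaplacian G).mulVec (fun v => √(G.degree v) * f v) =
      adjSum G (fun u v => (f u - f v) ^ 2) / 2 := by
  have hs : ∀ v, √(G.degree v : ℝ) ≠ 0 := fun v =>
    (Real.sqrt_pos.2 (Nat.cast_pos.2 (hdeg v))).ne'
  have h1 : (normLaplacian G).mulVec (fun v => √(G.degree v) * f v) = fun u =>
      √(G.degree u) * f u - (√(G.degree u))⁻¹ * ∑ v, if G.Adj u v then f v else 0 := by
    funext u
    rw [normLaplacian, Matrix.sub_mulVec, Matrix.one_mulVec, Pi.sub_apply]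
    congr 1
    simp only [Matrix.mulVec, dotProduct, Matrix.mul_diagonal, Matrix.diagonal_mul,
      SimpleGraph.adjMatrix_apply, mul_sum]
    refine sum_congr rfl fun v _ => ?_
    split_ifs
    · field_simp [hs u, hs v]
    · simp
  have h2 : adjSum G (fun u v => (f u - f v) ^ 2) =
      2 * ∑ u, (G.degree u : ℝ) * f u ^ 2 + (-2) * adjSum G (fun u v => f u * f v) := by
    rw [two_mul]
    nth_rewrite 1 [← adjSum_left (fun u => f u ^ 2)]
    rw [← adjSum_right (fun u => f u ^ 2), ← adjSum_const_mul, ← adjSum_add, ← adjSum_add]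
    congr 1
    funext u v
    ring
  have h3 : adjSum G (fun u v => f u * f v) = ∑ u, f u * ∑ v, if G.Adj u v then f v else 0 := by
    simp only [adjSum, mul_sum, mul_ite, mul_zero]
  rw [h1, h2, h3, dotProduct]
  have h4 : ∑ u, √(G.degree u : ℝ) * f u * (√(G.degree u) * f u -
      (√(G.degree u))⁻¹ * ∑ v, if G.Adj u v then f v else 0) =
      ∑ u, (G.degree u : ℝ) * f u ^ 2 - ∑ u, f u * ∑ v, if G.Adj u v then f v else 0 := by
    rw [← sum_sub_distrib]
    refine sum_congr rfl fun u _ => ?_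
    have := Real.mul_self_sqrt (Nat.cast_nonneg (α := ℝ) (G.degree u))
    have h5 := mul_inv_cancel₀ (hs u)
    linear_combination (f u ^ 2) * this - f u * (∑ v, if G.Adj u v then f v else 0) * h5
  rw [h4]
  ring

theorem dotProduct_sqrt_degree_mul_self (f : V → ℝ) :
    (fun v => √(G.degree v : ℝ) * f v) ⬝ᵥ (fun v => √(G.degree v : ℝ) * f v) =
      ∑ v, (G.degree v : ℝ) * f v ^ 2 := by
  refine sum_congr rfl fun v _ => ?_
  linear_combination (f v ^ 2) * Real.mul_self_sqrt (Nat.cast_nonneg (α := ℝ) (G.degree v))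

theorem eq_sqrt_degree_mul_div (hdeg : ∀ v, 0 < G.degree v) (x : V → ℝ) :
    x = fun v => √(G.degree v : ℝ) * (x v / √(G.degree v : ℝ)) := by
  funext v
  rw [mul_div_cancel₀]
  exact (Real.sqrt_pos.2 (Nat.cast_pos.2 (hdeg v))).ne'

theorem dotProduct_normLaplacian_nonneg (hdeg : ∀ v, 0 < G.degree v) (x : V → ℝ) :
    0 ≤ x ⬝ᵥ (normLaplacian G).mulVec x := by
  rw [eq_sqrt_degree_mul_div hdeg x, dotProduct_normLaplacian_mulVec hdeg]
  exact div_nonneg (adjSum_nonneg fun _ _ => sq_nonneg _) zero_le_two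

theorem dotProduct_normLaplacian_comm (x y : V → ℝ) :
    x ⬝ᵥ (normLaplacian G).mulVec y = (normLaplacian G).mulVec x ⬝ᵥ y := by
  have h := (normLaplacian_isHermitian G).eq
  rw [Matrix.conjTranspose_eq_transpose_of_trivial] at h
  rw [Matrix.dotProduct_mulVec, ← Matrix.mulVec_transpose, h]

theorem normLaplacian_mulVec_sqrt_degree (hdeg : ∀ v, 0 < G.degree v) :
    (normLaplacian G).mulVec (fun v => √(G.degree v : ℝ)) = 0 := by
  funext u
  have hs : ∀ v, √(G.degree v : ℝ) ≠ 0 := fun v =>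
    (Real.sqrt_pos.2 (Nat.cast_pos.2 (hdeg v))).ne'
  rw [normLaplacian, Matrix.sub_mulVec, Matrix.one_mulVec, Pi.sub_apply]
  simp only [Matrix.mulVec, dotProduct, Matrix.mul_diagonal, Matrix.diagonal_mul,
      SimpleGraph.adjMatrix_apply, mul_assoc, inv_mul_cancel₀ (hs _), mul_one]
  rw [← mul_sum, sum_boole, ← SimpleGraph.neighborFinset_eq_filter,
    SimpleGraph.card_neighborFinset_eq_degree, Pi.zero_apply]
  have := Real.mul_self_sqrt (Nat.cast_nonneg (α := ℝ) (G.degree u))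
  have h5 := hs u
  field_simp
  linarith

/-- Locates the two smallest eigenvalues in Mathlib's indexing by `V`: `eigenvalues` is the
decreasing list `eigenvalues₀` carried along the equivalence `e`, so they sit at positions `card V -
1` and `card V - 2`. -/
theorem exists_two_bottom_eigenvalues (hV : 2 ≤ Fintype.card V) :
    ∃ i j : V, i ≠ j ∧ (normLaplacian_isHermitian G).eigenvalues i ≤ eigenvalue G 2 ∧
      (normLaplacian_isHermitian G).eigenvalues j = eigenvalue G 2 ∧
      ∀ k, k ≠ i → eigenvalue G 2 ≤ (normLaplacian_isHermitian G).eigenvalues k := by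
  set hA := normLaplacian_isHermitian G
  let e : Fin (Fintype.card V) ≃ V := Fintype.equivOfCardEq (Fintype.card_fin _)
  have he : ∀ k, hA.eigenvalues (e k) = hA.eigenvalues₀ k := fun k => by
    simp only [Matrix.IsHermitian.eigenvalues, e, Equiv.symm_apply_apply]
  have h2 : eigenvalue G 2 = hA.eigenvalues₀ ⟨Fintype.card V - 2, by omega⟩ := by
    rw [eigenvalue, dif_pos ⟨one_le_two, hV⟩]
  refine ⟨e ⟨Fintype.card V - 1, by omega⟩, e ⟨Fintype.card V - 2, by omega⟩, ?_, ?_, ?_, ?_⟩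
  · rw [e.injective.ne_iff, Ne, Fin.mk.injEq]
    omega
  · rw [he, h2]
    exact hA.eigenvalues₀_antitone (Fin.mk_le_mk.2 (by omega))
  · rw [he, h2]
  · intro k hk
    obtain ⟨l, rfl⟩ := e.surjective k
    rw [he, h2]
    refine hA.eigenvalues₀_antitone ?_
    have : l ≠ ⟨Fintype.card V - 1, by omega⟩ := fun h => hk (by rw [h])
    rw [Ne, Fin.ext_iff] at this
    rw [Fin.le_def]
    have := l.2
    dsimp only at *
    omega

/-- The Courant–Fischer bound, by expansion in the eigenbasis: the one coefficient whose eigenvalue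
may lie below `c` vanishes. -/
theorem mul_dotProduct_self_le {c : ℝ} {i : V} {x : V → ℝ}
    (h : ∀ k, k ≠ i → c ≤ (normLaplacian_isHermitian G).eigenvalues k)
    (hx : ⇑((normLaplacian_isHermitian G).eigenvectorBasis i) ⬝ᵥ x = 0) :
    c * (x ⬝ᵥ x) ≤ x ⬝ᵥ (normLaplacian G).mulVec x := by
  set hA := normLaplacian_isHermitian G
  have hexp : ∀ y : V → ℝ, x ⬝ᵥ y =
      ∑ k, (⇑(hA.eigenvectorBasis k) ⬝ᵥ x) * (⇑(hA.eigenvectorBasis k) ⬝ᵥ y) := fun y => by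
    have := hA.eigenvectorBasis.sum_inner_mul_inner (WithLp.toLp 2 x) (WithLp.toLp 2 y)
    simp only [EuclideanSpace.inner_eq_star_dotProduct, star_trivial] at this
    rw [dotProduct_comm, ← this]
    refine sum_congr rfl fun k _ => ?_
    rw [dotProduct_comm y]
  rw [hexp, hexp, mul_sum]
  refine sum_le_sum fun k _ => ?_
  rw [dotProduct_normLaplacian_comm, hA.mulVec_eigenvectorBasis, smul_dotProduct, smul_eq_mul]
  by_cases hk : k = i
  · subst hk
    simp [hx]
  · have := mul_le_mul_of_nonneg_right (h k hk) (mul_self_nonneg (⇑(hA.eigenvectorBasis k) ⬝ᵥ x))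
    linarith

theorem exists_orthogonal_pair (p q : ℝ) : ∃ α β : ℝ, 0 < α ^ 2 + β ^ 2 ∧ α * p + β * q = 0 := by
  by_cases h : p = 0
  · exact ⟨1, 0, by norm_num, by simp [h]⟩
  · exact ⟨-q, p, by positivity, by ring⟩

theorem exists_isSecondEigenfunction (hdeg : ∀ v, 0 < G.degree v) (hV : 2 ≤ Fintype.card V) :
    ∃ g, IsSecondEigenfunction G g := by
  obtain ⟨i, j, hij, hi, hj, -⟩ := exists_two_bottom_eigenvalues (G := G) hV
  set hA := normLaplacian_isHermitian G
  have hor : ∀ k l, ⇑(hA.eigenvectorBasis k) ⬝ᵥ ⇑(hA.eigenvectorBasis l) =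
      if k = l then (1 : ℝ) else 0 := fun k l => by
    rw [← orthonormal_iff_ite.1 hA.eigenvectorBasis.orthonormal k l,
      EuclideanSpace.inner_eq_star_dotProduct, star_trivial, dotProduct_comm]
  -- If `λ₂ = 0`, both bottom basis vectors lie in the kernel and neither need be orthogonal to
  -- `√deg`, but some nonzero combination is. If `λ₂ ≠ 0`, orthogonality follows from symmetry, as
  -- `√deg` lies in the kernel.
  by_cases h0 : eigenvalue G 2 = 0
  · have hi0 : hA.eigenvalues i = 0 := by
      refine le_antisymm (hi.trans h0.le) ?_
      have := dotProduct_normLaplacian_nonneg hdeg ⇑(hA.eigenvectorBasis i)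
      rwa [hA.mulVec_eigenvectorBasis, dotProduct_smul, hor, if_pos rfl, smul_eq_mul,
        mul_one] at this
    obtain ⟨α, β, hαβ, h⟩ := exists_orthogonal_pair
      ((fun v => √(G.degree v : ℝ)) ⬝ᵥ ⇑(hA.eigenvectorBasis i))
      ((fun v => √(G.degree v : ℝ)) ⬝ᵥ ⇑(hA.eigenvectorBasis j))
    refine ⟨α • ⇑(hA.eigenvectorBasis i) + β • ⇑(hA.eigenvectorBasis j), ?_, ?_, ?_⟩
    · intro hz
      have : (α • ⇑(hA.eigenvectorBasis i) + β • ⇑(hA.eigenvectorBasis j)) ⬝ᵥ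
          (α • ⇑(hA.eigenvectorBasis i) + β • ⇑(hA.eigenvectorBasis j)) = α ^ 2 + β ^ 2 := by
        simp only [add_dotProduct, dotProduct_add, smul_dotProduct, dotProduct_smul, hor, hij,
          hij.symm, if_true, if_false, smul_eq_mul]
        ring
      rw [hz, zero_dotProduct] at this
      linarith
    · rw [Matrix.mulVec_add, Matrix.mulVec_smul, Matrix.mulVec_smul, hA.mulVec_eigenvectorBasis,
        hA.mulVec_eigenvectorBasis, hi0, hj, h0]
      simp
    · change (fun v => √(G.degree v : ℝ)) ⬝ᵥ _ = 0
      rw [dotProduct_add, dotProduct_smul, dotProduct_smul]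
      exact h
  · refine ⟨⇑(hA.eigenvectorBasis j), ?_, ?_, ?_⟩
    · intro hz
      have := hor j j
      rw [hz, zero_dotProduct, if_pos rfl] at this
      exact zero_ne_one this
    · rw [hA.mulVec_eigenvectorBasis, hj]
    · have h1 := dotProduct_normLaplacian_comm (G := G) (fun v => √(G.degree v : ℝ))
        ⇑(hA.eigenvectorBasis j)
      rw [normLaplacian_mulVec_sqrt_degree hdeg, hA.mulVec_eigenvectorBasis, hj, zero_dotProduct,
        dotProduct_smul, smul_eq_mul] at h1
      exact (mul_eq_zero.1 h1).resolve_left h0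

/-- A balanced cut bounds the second eigenvalue. -/
theorem eigenvalue_two_le (hdeg : ∀ v, 0 < G.degree v) {A : Finset V} (hA : IsCut A)
    (hvol : vol G A = vol G Aᶜ) : eigenvalue G 2 ≤ 2 * conductance G A := by
  have hV : 2 ≤ Fintype.card V := by
    have h1 := hA.1.card_pos
    have h2 := hA.2.card_pos
    have := card_add_card_compl A
    omega
  have hpos : 0 < vol G A := by
    obtain ⟨v, hv⟩ := hA.1
    exact (hdeg v).trans_le (single_le_sum (f := fun v => G.degree v)
      (fun _ _ => Nat.zero_le _) hv)
  obtain ⟨i, -, -, -, -, hk⟩ := exists_two_bottom_eigenvalues (G := G) hV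
  set b := ⇑((normLaplacian_isHermitian G).eigenvectorBasis i) with hb
  -- The bottom basis vector `b` need not be proportional to `√deg` when `λ₂ = 0`, so the values of
  -- the test function are fitted to `b` instead of taken as `1` and `-1`.
  obtain ⟨α, β, hαβ, h⟩ := exists_orthogonal_pair
    (∑ v ∈ A, b v * √(G.degree v : ℝ)) (∑ v ∈ Aᶜ, b v * √(G.degree v : ℝ))
  set f : V → ℝ := fun v => if v ∈ A then α else β with hf
  have hsplit : ∀ F : V → ℝ, ∑ v, F v = ∑ v ∈ A, F v + ∑ v ∈ Aᶜ, F v := fun F =>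
    (sum_add_sum_compl A F).symm
  have hor : b ⬝ᵥ (fun v => √(G.degree v : ℝ) * f v) = 0 := by
    rw [dotProduct, hsplit, ← h, mul_sum, mul_sum]
    congr 1
    · refine sum_congr rfl fun v hv => ?_
      simp only [hf, hv, if_true]; ring
    · refine sum_congr rfl fun v hv => ?_
      simp only [hf, mem_compl.1 hv, if_false]; ring
  have hR := mul_dotProduct_self_le hk hor
  rw [dotProduct_normLaplacian_mulVec hdeg, dotProduct_sqrt_degree_mul_self] at hR
  have hE : adjSum G (fun u v => (f u - f v) ^ 2) =
      (α - β) ^ 2 * (2 * (G.interedges A Aᶜ).card) := by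
    rw [← adjSum_indicator, ← adjSum_const_mul]
    congr 1
    funext u v
    by_cases hu : u ∈ A <;> by_cases hv : v ∈ A <;> simp [hf, hu, hv]
    ring
  have hN : ∑ v, (G.degree v : ℝ) * f v ^ 2 = (α ^ 2 + β ^ 2) * vol G A := by
    have h1 : ∑ v ∈ A, (G.degree v : ℝ) * f v ^ 2 = α ^ 2 * vol G A := by
      rw [vol, Nat.cast_sum, mul_sum]
      refine sum_congr rfl fun v hv => ?_
      simp only [hf, hv, if_true]; ring
    have h2 : ∑ v ∈ Aᶜ, (G.degree v : ℝ) * f v ^ 2 = β ^ 2 * vol G Aᶜ := by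
      rw [vol, Nat.cast_sum, mul_sum]
      refine sum_congr rfl fun v hv => ?_
      simp only [hf, mem_compl.1 hv, if_false]; ring
    rw [hsplit, h1, h2, ← hvol]
    ring
  have hc : ((G.interedges A Aᶜ).card : ℝ) = conductance G A * vol G A := by
    rw [conductance, ← hvol, min_self, div_mul_cancel₀]
    exact Nat.cast_ne_zero.2 hpos.ne'
  rw [hE, hN, hc] at hR
  have hvp : (0 : ℝ) < vol G A := Nat.cast_pos.2 hpos
  have hcn : 0 ≤ conductance G A * vol G A := mul_nonneg (conductance_nonneg A) hvp.le
  refine le_of_mul_le_mul_right ?_ (mul_pos hαβ hvp)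
  have : (α - β) ^ 2 * (conductance G A * vol G A) ≤
      2 * (α ^ 2 + β ^ 2) * (conductance G A * vol G A) :=
    mul_le_mul_of_nonneg_right (by nlinarith [sq_nonneg (α + β)]) hcn
  linarith

/-! ### Outputs of spectral partitioning. -/

theorem exists_isBestThresholdCut {f : V → ℝ} {u v : V} (h : f u < f v) :
    ∃ S, IsBestThresholdCut G f S := by
  classical
  have hne : (univ.filter fun S : Finset V => IsCut S ∧ ∃ t, S = thresholdSet f t).Nonempty := by
    refine ⟨thresholdSet f (f v), ?_⟩
    simp only [mem_filter, mem_univ, true_and]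
    refine ⟨⟨⟨v, ?_⟩, u, ?_⟩, _, rfl⟩
    · simp [thresholdSet]
    · simpa [thresholdSet] using h
  obtain ⟨S, hS, hmin⟩ := exists_min_image _ (conductance G) hne
  simp only [mem_filter, mem_univ, true_and] at hS hmin
  exact ⟨S, hS.1, hS.2, fun t ht => hmin _ ⟨ht, t, rfl⟩⟩

/-- A nonzero function orthogonal to the positive vector `√deg` takes both signs, so its rescaling
is not constant and has a threshold cut. -/
theorem exists_isSpectralPartition (hdeg : ∀ v, 0 < G.degree v) (hV : 2 ≤ Fintype.card V) :
    ∃ S, IsSpectralPartition G S := by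
  obtain ⟨g, hg⟩ := exists_isSecondEigenfunction hdeg hV
  have hs : ∀ v, 0 < √(G.degree v : ℝ) := fun v => Real.sqrt_pos.2 (Nat.cast_pos.2 (hdeg v))
  obtain ⟨u, hu⟩ : ∃ u, g u < 0 := by
    by_contra! hc
    refine hg.1 (funext fun v => ?_)
    have := (sum_eq_zero_iff_of_nonneg fun v _ => mul_nonneg (hs v).le (hc v)).1 hg.2.2 v
      (mem_univ v)
    exact (mul_eq_zero.1 this).resolve_left (hs v).ne'
  obtain ⟨v, hv⟩ : ∃ v, 0 < g v := by
    by_contra! hc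
    have : 0 < ∑ w, -(√(G.degree w : ℝ) * g w) :=
      sum_pos' (fun w _ => neg_nonneg.2 (mul_nonpos_of_nonneg_of_nonpos (hs w).le (hc w)))
        ⟨u, mem_univ u, neg_pos.2 (mul_neg_of_pos_of_neg (hs u) hu)⟩
    rw [sum_neg_distrib, hg.2.2, neg_zero] at this
    exact lt_irrefl _ this
  obtain ⟨S, hS⟩ := exists_isBestThresholdCut (G := G)
    (f := fun v => g v / √(G.degree v : ℝ)) (u := u) (v := v)
    ((div_neg_of_neg_of_pos hu (hs u)).trans (div_pos hv (hs v)))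
  exact ⟨S, g, hg, hS⟩

/-- If `√deg · f` is an eigenfunction orthogonal to `√deg` that is close to a function with two
values, some threshold cut of `f` has small conductance. -/
theorem conductance_le_of_step (hdeg : ∀ v, 0 < G.degree v) {g g' : V → ℝ} {S : Finset V}
    {a b K ϕ : ℝ} (hg : IsSecondEigenfunction G g)
    (hS : IsBestThresholdCut G (fun v => g v / √(G.degree v : ℝ)) S)
    (hg' : ∀ v, g' v = a ∨ g' v = b) (hK : 1 ≤ K) (hϕ : 0 < ϕ) (hϕ1 : ϕ ≤ 1)
    (hP : ϕ ^ 2 * ∑ v, (G.degree v : ℝ) * (g v / √(G.degree v : ℝ) - g' v) ^ 2 ≤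
      K * adjSum G (fun u v => (g u / √(G.degree u : ℝ) - g v / √(G.degree v : ℝ)) ^ 2)) :
    conductance G S ≤ 24 * (eigenvalue G 2 / ϕ * K) := by
  set f : V → ℝ := fun v => g v / √(G.degree v : ℝ) with hf
  have hs : ∀ v, 0 < √(G.degree v : ℝ) := fun v => Real.sqrt_pos.2 (Nat.cast_pos.2 (hdeg v))
  have hgf : g = fun v => √(G.degree v : ℝ) * f v := eq_sqrt_degree_mul_div hdeg g
  obtain ⟨x, hx⟩ : ∃ x, g x ≠ 0 := Function.ne_iff.1 hg.1
  have : Nonempty V := ⟨x⟩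
  set N := ∑ v, (G.degree v : ℝ) * f v ^ 2 with hN
  set E := adjSum G (fun u v => (f u - f v) ^ 2) with hE
  have hNpos : 0 < N := by
    refine sum_pos' (fun v _ => by positivity) ⟨x, mem_univ x, ?_⟩
    have h1 : (0 : ℝ) < G.degree x := Nat.cast_pos.2 (hdeg x)
    have h2 : f x ≠ 0 := div_ne_zero hx (hs x).ne'
    positivity
  have hEN : E / 2 = eigenvalue G 2 * N := by
    rw [hE, hN, ← dotProduct_normLaplacian_mulVec hdeg, ← dotProduct_sqrt_degree_mul_self, ← hgf,
      hg.2.1, dotProduct_smul, smul_eq_mul]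
  have hE0 : 0 ≤ E := adjSum_nonneg fun _ _ => sq_nonneg _
  have hsum : ∑ v, (G.degree v : ℝ) * f v = 0 := by
    rw [← hg.2.2]
    refine sum_congr rfl fun v _ => ?_
    have h1 := congrFun hgf v
    rw [h1]
    linear_combination -(f v) * Real.mul_self_sqrt (Nat.cast_nonneg (α := ℝ) (G.degree v))
  -- The choice `s = ϕ⁻¹` makes both `(1 + s) * E` and `s⁻¹ * P` at most a constant times `K * E /
  -- ϕ`; the first uses `ϕ ≤ 1` and `1 ≤ K`.
  have h1 := mul_sum_sq_le_of_step (conductance_nonneg S) hS.2.2 hg' hsum (inv_pos.2 hϕ)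
  rw [inv_inv, ← hN, ← hE] at h1
  set P := ∑ v, (G.degree v : ℝ) * (f v - g' v) ^ 2
  have h2 : ϕ * P ≤ K * E * ϕ⁻¹ := by
    rw [le_mul_inv_iff₀ hϕ]
    linarith
  have hi : 1 ≤ ϕ⁻¹ := (one_le_inv₀ hϕ).2 hϕ1
  have h3 : (1 + ϕ⁻¹) * E ≤ 2 * (K * E * ϕ⁻¹) := by
    have h4 : (1 + ϕ⁻¹) * E ≤ 2 * ϕ⁻¹ * E := mul_le_mul_of_nonneg_right (by linarith) hE0
    have h5 : 1 * (ϕ⁻¹ * E) ≤ K * (ϕ⁻¹ * E) :=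
      mul_le_mul_of_nonneg_right hK (mul_nonneg (by linarith) hE0)
    linarith
  refine le_of_mul_le_mul_right ?_ hNpos
  have h6 : E = 2 * (eigenvalue G 2 * N) := by linarith
  calc conductance G S * N ≤ 4 * (3 * (K * E * ϕ⁻¹)) := by linarith
    _ = 24 * (eigenvalue G 2 / ϕ * K) * N := by rw [h6, div_eq_mul_inv]; ring

/-! ### Passing between the graph and its induced subgraphs. -/

theorem degree_le_degree_induce_add {H : SimpleGraph V} [DecidableRel H.Adj] {A : Finset V}
    (h : ∀ u ∈ A, ∀ v ∉ A, G.Adj u v → H.Adj u v) (u : (A : Set V)) :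
    G.degree u ≤ (G.induce (A : Set V)).degree u + H.degree u := by
  simp only [← SimpleGraph.card_neighborFinset_eq_degree]
  rw [← card_map (Function.Embedding.subtype _)]
  refine (card_le_card fun v hv => ?_).trans (card_union_le _ _)
  rw [SimpleGraph.mem_neighborFinset] at hv
  rw [mem_union]
  by_cases hvA : v ∈ A
  · left
    refine mem_map.2 ⟨⟨v, hvA⟩, ?_, rfl⟩
    rw [SimpleGraph.mem_neighborFinset]
    exact hv
  · right
    rw [SimpleGraph.mem_neighborFinset]
    exact h u u.2 v hvA hv

theorem degree_induce_le (A : Finset V) (u : (A : Set V)) :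
    (G.induce (A : Set V)).degree u ≤ G.degree u := by
  simp only [← SimpleGraph.card_neighborFinset_eq_degree]
  rw [← card_map (Function.Embedding.subtype _)]
  refine card_le_card fun v hv => ?_
  obtain ⟨w, hw, rfl⟩ := mem_map.1 hv
  rw [SimpleGraph.mem_neighborFinset] at hw ⊢
  exact hw

theorem adjSum_induce_add_le {A B : Finset V} (hAB : Disjoint A B) {F : V → V → ℝ}
    (hF : ∀ u v, 0 ≤ F u v) :
    adjSum (G.induce (A : Set V)) (fun u v => F u v) +
      adjSum (G.induce (B : Set V)) (fun u v => F u v) ≤ adjSum G F := by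
  have h : ∀ A : Finset V, adjSum (G.induce (A : Set V)) (fun u v => F u v) ≤
      ∑ u ∈ A, ∑ v, if G.Adj u v then F u v else 0 := fun A => by
    rw [Finset.sum_subtype A (p := (· ∈ (A : Set V))) (fun x => by simp)]
    refine sum_le_sum fun u _ => ?_
    refine le_trans (le_of_eq ?_) (sum_le_sum_of_subset_of_nonneg (subset_univ A)
      fun v _ _ => ?_)
    · rw [Finset.sum_subtype A (p := (· ∈ (A : Set V))) (fun x => by simp)]
      rfl
    · split_ifs
      · exact hF u v
      · exact le_rfl
  refine (add_le_add (h A) (h B)).trans ?_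
  rw [← sum_union hAB]
  refine sum_le_sum_of_subset_of_nonneg (subset_univ _) fun u _ _ => sum_nonneg fun v _ => ?_
  split_ifs
  · exact hF u v
  · exact le_rfl

/-- The Poincaré inequality of an induced expander, with respect to the degrees of the ambient
graph. -/
theorem exists_poincare_induce {H : SimpleGraph V} [DecidableRel H.Adj] {A : Finset V}
    (h : ∀ u ∈ A, ∀ v ∉ A, G.Adj u v → H.Adj u v) {ϕ d₁ d₂ : ℝ} (hϕ : 0 < ϕ)
    (hA : ϕ ≤ graphConductance (G.induce (A : Set V))) (hd₁ : 0 < d₁)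
    (hmin : d₁ ≤ (G.induce (A : Set V)).minDegree) (hmax : H.maxDegree ≤ d₂) (f : V → ℝ) :
    ∃ m, ϕ ^ 2 * ∑ v ∈ A, (G.degree v : ℝ) * (f v - m) ^ 2 ≤
      (d₁ + d₂) / d₁ * adjSum (G.induce (A : Set V)) (fun u v => (f u - f v) ^ 2) := by
  obtain ⟨S, ⟨x, -⟩, -⟩ := exists_isCut_of_graphConductance_pos (hϕ.trans_le hA)
  have : Nonempty (A : Set V) := ⟨x⟩
  obtain ⟨m, hm⟩ := exists_poincare hϕ hA (fun v => f v)
  refine ⟨m, ?_⟩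
  have hd₂ : 0 ≤ d₂ := (Nat.cast_nonneg _).trans hmax
  refine le_trans ?_ (mul_le_mul_of_nonneg_left hm (by positivity))
  rw [Finset.sum_subtype A (p := (· ∈ (A : Set V))) (fun x => by simp), mul_left_comm]
  refine mul_le_mul_of_nonneg_left ?_ (by positivity)
  rw [mul_sum]
  refine sum_le_sum fun u _ => ?_
  rw [← mul_assoc]
  refine mul_le_mul_of_nonneg_right ?_ (sq_nonneg _)
  have h1 : (G.degree u : ℝ) ≤ (G.induce (A : Set V)).degree u + H.degree u := by
    exact_mod_cast degree_le_degree_induce_add h u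
  have h2 : d₁ ≤ (G.induce (A : Set V)).degree u :=
    hmin.trans (Nat.cast_le.2 (SimpleGraph.minDegree_le_degree _ _))
  have h3 : (H.degree u : ℝ) ≤ d₂ :=
    (Nat.cast_le.2 (SimpleGraph.degree_le_maxDegree _ _)).trans hmax
  rw [div_mul_eq_mul_div, le_div_iff₀ hd₁]
  -- With `a` the inner and `h` the outer degree, `d₁ * h ≤ d₁ * d₂ ≤ d₂ * a`, hence `d₁ * (a + h) ≤
  -- (d₁ + d₂) * a`.
  nlinarith [mul_le_mul_of_nonneg_left h2 hd₂]

end Graph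

end SpectralCut

/-! ### The main theorem. -/

theorem corollary4p15 :
    ∃ C : ℝ, 0 < C ∧
      ∀ (V : Type*) [Fintype V] [DecidableEq V] (G : SimpleGraph V) [DecidableRel G.Adj]
        (A B : Finset V) (φ ϕ d₁ d₂ : ℝ),
        Disjoint A B → A ∪ B = Finset.univ →
        SpectralCut.vol G A = SpectralCut.vol G B →
        SpectralCut.conductance G A = φ → SpectralCut.conductance G B = φ →
        0 < ϕ →
        ϕ ≤ min (SpectralCut.graphConductance (G.induce (A : Set V)))
              (SpectralCut.graphConductance (G.induce (B : Set V))) →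
        0 < d₁ →
        d₁ ≤ (G.induce (A : Set V)).minDegree →
        d₁ ≤ (G.induce (B : Set V)).minDegree →
        (G.between (A : Set V) (B : Set V)).maxDegree ≤ d₂ →
        (∃ S, SpectralCut.IsSpectralPartition G S) ∧
          ∀ S, SpectralCut.IsSpectralPartition G S →
            SpectralCut.conductance G S ≤ C * ((φ / ϕ) * ((d₁ + d₂) / d₁)) := by
  -- `48 = 24 * 2`: the `24` of `conductance_le_of_step` times the `2` in `λ₂ ≤ 2 φ`.
  refine ⟨48, by norm_num, ?_⟩
  intro V _ _ G _ A B φ ϕ d₁ d₂ hdisj hunion hvol hφA _ hϕ hmin hd₁ hdA hdB hd₂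
  have hBA : B = Aᶜ := by
    ext v
    have h1 : v ∈ A ∪ B := hunion ▸ Finset.mem_univ v
    rw [Finset.mem_union] at h1
    rw [Finset.mem_compl]
    exact ⟨fun hB hA => Finset.disjoint_left.1 hdisj hA hB, h1.resolve_left⟩
  obtain ⟨hϕA, hϕB⟩ := le_min_iff.1 hmin
  have hdeg : ∀ v, 0 < G.degree v := by
    have key : ∀ A : Finset V, d₁ ≤ (G.induce (A : Set V)).minDegree →
        ∀ v ∈ A, 0 < G.degree v := fun A hA v hv => by
      have h1 := SpectralCut.degree_induce_le (G := G) A ⟨v, hv⟩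
      have h2 := (G.induce (A : Set V)).minDegree_le_degree ⟨v, hv⟩
      have h3 : 0 < (G.induce (A : Set V)).minDegree := Nat.cast_pos.1 (hd₁.trans_le hA)
      exact h3.trans_le (h2.trans h1)
    intro v
    have h1 : v ∈ A ∪ B := hunion ▸ Finset.mem_univ v
    exact (Finset.mem_union.1 h1).elim (key A hdA v) (key B hdB v)
  -- A cut inside each side shows that `A` and `B` are nonempty, and that `ϕ ≤ 1` because no cut has
  -- conductance above `1`.
  obtain ⟨T, hT⟩ := SpectralCut.exists_isCut_of_graphConductance_pos (hϕ.trans_le hϕA)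
  obtain ⟨T', hT'⟩ := SpectralCut.exists_isCut_of_graphConductance_pos (hϕ.trans_le hϕB)
  have hϕ1 : ϕ ≤ 1 := hϕA.trans
    ((SpectralCut.graphConductance_le hT).trans (SpectralCut.conductance_le_one T))
  have hcut : SpectralCut.IsCut A := by
    obtain ⟨x, -⟩ := hT.1
    obtain ⟨y, -⟩ := hT'.1
    exact ⟨⟨x, x.2⟩, ⟨y, hBA ▸ y.2⟩⟩
  have hV : 2 ≤ Fintype.card V := by
    have h1 := hcut.1.card_pos
    have h2 := hcut.2.card_pos
    have := Finset.card_add_card_compl A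
    omega
  refine ⟨SpectralCut.exists_isSpectralPartition hdeg hV, ?_⟩
  rintro S ⟨g, hg, hS⟩
  set f : V → ℝ := fun v => g v / √(G.degree v : ℝ) with hf
  have hd₂0 : 0 ≤ d₂ := (Nat.cast_nonneg _).trans hd₂
  have hK : 1 ≤ (d₁ + d₂) / d₁ := by
    rw [le_div_iff₀ hd₁]
    linarith
  obtain ⟨a, ha⟩ := SpectralCut.exists_poincare_induce (G := G)
    (H := G.between (A : Set V) (B : Set V)) (A := A) (fun u hu v hv huv => by
      rw [SimpleGraph.between_adj]
      exact ⟨huv, Or.inl ⟨hu, by simpa [hBA] using hv⟩⟩) hϕ hϕA hd₁ hdA hd₂ f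
  obtain ⟨b, hb⟩ := SpectralCut.exists_poincare_induce (G := G)
    (H := G.between (A : Set V) (B : Set V)) (A := B) (fun u hu v hv huv => by
      rw [SimpleGraph.between_adj]
      exact ⟨huv, Or.inr ⟨hu, by simpa [hBA] using hv⟩⟩) hϕ hϕB hd₁ hdB hd₂ f
  have hsum := SpectralCut.adjSum_induce_add_le (G := G) hdisj
    (F := fun u v => (f u - f v) ^ 2) (fun _ _ => sq_nonneg _)
  -- The step function takes on each side the centre given by that side's Poincaré inequality. The
  -- two inequalities add up, since the edges inside `A` and inside `B` are disjoint families of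
  -- edges of `G`.
  have hmain := SpectralCut.conductance_le_of_step hdeg hg hS
    (g' := fun v => if v ∈ A then a else b) (a := a) (b := b) (K := (d₁ + d₂) / d₁)
    (fun v => by by_cases hv : v ∈ A <;> simp [hv]) hK hϕ hϕ1 (by
      have h1 : ∑ v ∈ A, (G.degree v : ℝ) * (f v - if v ∈ A then a else b) ^ 2 =
          ∑ v ∈ A, (G.degree v : ℝ) * (f v - a) ^ 2 :=
        Finset.sum_congr rfl fun v hv => by rw [if_pos hv]
      have h2 : ∑ v ∈ B, (G.degree v : ℝ) * (f v - if v ∈ A then a else b) ^ 2 =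
          ∑ v ∈ B, (G.degree v : ℝ) * (f v - b) ^ 2 :=
        Finset.sum_congr rfl fun v hv => by rw [if_neg (Finset.disjoint_right.1 hdisj hv)]
      rw [← hunion, Finset.sum_union hdisj, h1, h2, mul_add]
      refine (add_le_add ha hb).trans ?_
      rw [← mul_add]
      exact mul_le_mul_of_nonneg_left hsum (by linarith))
  have hl := SpectralCut.eigenvalue_two_le hdeg hcut (hBA ▸ hvol)
  rw [hφA] at hl
  refine hmain.trans ?_
  have h3 : SpectralCut.eigenvalue G 2 / ϕ * ((d₁ + d₂) / d₁) ≤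
      2 * φ / ϕ * ((d₁ + d₂) / d₁) :=
    mul_le_mul_of_nonneg_right (div_le_div_of_nonneg_right hl hϕ.le) (by linarith)
  rw [mul_div_assoc] at h3
  linarith
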